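/- Let $A$, $B$, $C$ be countable sets, each with its discrete $\sigma$-algebra. A (possibly time-inhomogeneous) Markov chain on a countable set $S$ is a stochastic process $W=(W_t)_{t\ge 0}$, $t\in\{0,1,2,\dots\}$, with values in $S$, for which there are a probability distribution $\alpha$ on $S$ and stochastic matrices $P_1,P_2,\dots$ on $S$ such that $$\mathbb P(W_0=x_0,\dots,W_n=x_n)=\alpha(x_0)\prod_{t=1}^{n}P_t(x_{t-1},x_t)\qquad\text{for all } n\ge 0,\ x_0,\dots,x_n\in S.$$ Let $\bar X=(\bar X_t)_{t\ge0}$, $\bar Y=(\bar Y_t)_{t\ge0}$ and $\bar Z=(\bar Z_t)_{t\ge0}$ be such (possibly time-inhomogeneous) Markov chains on $A$, $B$ and $C$ respectively, and suppose that for maps $f:A\to C$ and $g:B\to C$ $$\bigl(f(\bar X_t)\bigr)_{t\ge0}\overset{\mathrm d}{=}\bar Z\overset{\mathrm d}{=}\bigl(g(\bar Y_t)\bigr)_{t\ge0}.$$ Then there exists a (possibly time-inhomogeneous) Markov chain $(X_t,Y_t)_{t\ge0}$ on $A\times B$ such that $$(X_t)_{t\ge0}\overset{\mathrm d}{=}\bar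 X,\qquad (Y_t)_{t\ge0}\overset{\mathrm d}{=}\bar Y,\qquad f(X_t)=g(Y_t)\ \text{ for all } t\ge0,$$ and such that moreover, writing $Z_t=f(X_t)=g(Y_t)$ (so that $Z\overset{\mathrm d}{=}\bar Z$), the processes $X=(X_t)_{t\ge0}$ and $Y=(Y_t)_{t\ge0}$ are conditionally independent given the entire process $Z=(Z_t)_{t\ge0}$. -/

import Mathlib

open MeasureTheory ProbabilityTheory

universe u v w u' v' w'

/-- The process `X = (X_t)_{t ≥ 0}` with values in `S`, on the probability space `(Ω, μ)`, is the
(possibly time-inhomogeneous) Markov chain with initial distribution `α` and successive transition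
matrices `P 0, P 1, …`, where `P t` governs the step from time `t` to time `t + 1`. Every row
`P t x` is a probability distribution on `S`, so that every `P t` is a stochastic matrix. -/
structure IsMC {Ω : Type*} [MeasurableSpace Ω] {S : Type*} [MeasurableSpace S]
    (μ : Measure Ω) (X : ℕ → Ω → S) (α : PMF S) (P : ℕ → S → PMF S) : Prop where
  measurable : ∀ t, Measurable (X t)
  law : ∀ (n : ℕ) (x : ℕ → S),
    μ {ω | ∀ t ≤ n, X t ω = x t} = α (x 0) * ∏ t ∈ Finset.range n, P t (x t) (x (t + 1))

/-- `X` is a discrete-time Markov chain, not necessarily time-homogeneous: it has some initial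
distribution and some sequence of stochastic transition matrices, one for each time step. -/
def IsMarkovChain {Ω : Type*} [MeasurableSpace Ω] {S : Type*} [MeasurableSpace S]
    (μ : Measure Ω) (X : ℕ → Ω → S) : Prop :=
  ∃ (α : PMF S) (P : ℕ → S → PMF S), IsMC μ X α P

/-- The whole trajectory `ω ↦ (X_t(ω))_{t ≥ 0}`, a random element of the sequence space `ℕ → S`
(with the product σ-algebra). -/
def trajectory {Ω : Type*} {S : Type*} (X : ℕ → Ω → S) : Ω → (ℕ → S) :=
  fun ω t => X t ω

/-- The image process `f(X) = (f(X_t))_{t ≥ 0}`. -/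
def imageProcess {Ω : Type*} {S T : Type*} (f : S → T) (X : ℕ → Ω → S) : ℕ → Ω → T :=
  fun t ω => f (X t ω)

/-! Let `P`, `P'` be the path laws of the two chains and `ν` their common image on paths in `C`. The
coupling is the relatively independent one: draw `z` from `ν`, then `x` and `y` independently from
the conditional laws given `z`. Marginals, the equality of images and conditional independence hold
for any two laws with a common image; only the Markov property of the pair needs an argument.

Since `ν` is Markov, its future after a cylinder of `z` at time `n` has a law `ρ (z n)`. By Bayes'
rule the conditional probability of the cylinder of `x` given the image path is `P(cyl x) / ν(cyl
z)` times a density `φ (x n)`, evaluated at the future of `z` (`exists_condDistrib_pathCylinder`).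
Multiplying by the analogous expression for `y` and integrating gives `ν(cyl z) * Q(cyl x × cyl y) =
P(cyl x) * P'(cyl y) * H (x n) (y n)` for the coupling `Q` and compatible `x`, `y`
(`exists_relativeProduct_pathCylinder`). Hence the ratio of `Q` at times `n + 1` and `n` depends
only on the last two states of the pair, which is the Markov property (`isMarkovChain_of_mul_comm`).
-/

open scoped ENNReal

/-! ### Cylinders, tails and concatenation of paths -/

/-- The set of paths that agree with `x` up to time `n`. -/
def pathCylinder {S : Type*} (n : ℕ) (x : ℕ → S) : Set (ℕ → S) := {w | ∀ t ≤ n, w t = x t}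

/-- The path seen from time `n` on. -/
def pathTail {S : Type*} (n : ℕ) (w : ℕ → S) : ℕ → S := fun t => w (n + t)

/-- The path that follows `x` before time `n`, and `y` (restarted) from time `n` on. -/
def pathConcat {S : Type*} (n : ℕ) (x y : ℕ → S) : ℕ → S := fun t => if t < n then x t else y (t - n)

section Paths

variable {S : Type*}

theorem pathConcat_of_lt {n t : ℕ} (x y : ℕ → S) (h : t < n) : pathConcat n x y t = x t := by
  simp [pathConcat, h]

theorem pathConcat_add (n t : ℕ) (x y : ℕ → S) : pathConcat n x y (n + t) = y t := by
  simp [pathConcat]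

theorem pathConcat_pathTail {n : ℕ} {x w : ℕ → S} (h : w ∈ pathCylinder n x) :
    pathConcat n x (pathTail n w) = w := by
  funext t
  by_cases ht : t < n
  · rw [pathConcat_of_lt _ _ ht, h t ht.le]
  · obtain ⟨k, rfl⟩ := Nat.exists_eq_add_of_le (not_lt.1 ht)
    rw [pathConcat_add]; rfl

theorem pathCylinder_succ_subset (n : ℕ) (x : ℕ → S) :
    pathCylinder (n + 1) x ⊆ pathCylinder n x := fun _ h t ht => h t (by omega)

theorem pathTail_preimage_pathCylinder_inter {n m : ℕ} {x y : ℕ → S} (h : y 0 = x n) :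
    pathTail n ⁻¹' pathCylinder m y ∩ pathCylinder n x
      = pathCylinder (n + m) (pathConcat n x y) := by
  ext w
  simp only [Set.mem_inter_iff, Set.mem_preimage, pathCylinder, Set.mem_ofPred_eq, pathTail]
  constructor
  · rintro ⟨h1, h2⟩ t ht
    by_cases htn : t < n
    · rw [pathConcat_of_lt _ _ htn, h2 t htn.le]
    · obtain ⟨k, rfl⟩ := Nat.exists_eq_add_of_le (not_lt.1 htn)
      rw [pathConcat_add, h1 k (by omega)]
  · intro h1
    refine ⟨fun t ht => by rw [h1 _ (by omega), pathConcat_add], fun t ht => ?_⟩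
    rw [h1 t (by omega)]
    rcases ht.lt_or_eq with ht | rfl
    · rw [pathConcat_of_lt _ _ ht]
    · simpa [h] using pathConcat_add t 0 x y

theorem pathTail_preimage_pathCylinder_inter_eq_empty {n m : ℕ} {x y : ℕ → S} (h : y 0 ≠ x n) :
    pathTail n ⁻¹' pathCylinder m y ∩ pathCylinder n x = ∅ := by
  ext w
  simp only [Set.mem_inter_iff, Set.mem_preimage, pathCylinder, Set.mem_ofPred_eq, pathTail,
    Set.mem_empty_iff_false, iff_false, not_and]
  intro h1 h2
  exact h (by rw [← h1 0 (Nat.zero_le _), ← h2 n le_rfl, add_zero])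

variable [MeasurableSpace S]

theorem measurable_pathTail (n : ℕ) : Measurable (pathTail n : (ℕ → S) → ℕ → S) :=
  measurable_pi_lambda _ fun t => measurable_pi_apply (n + t)

theorem measurable_pathConcat (n : ℕ) (x : ℕ → S) : Measurable (pathConcat n x) := by
  refine measurable_pi_lambda _ fun t => ?_
  by_cases h : t < n
  · simp only [pathConcat, h, if_true]; exact measurable_const
  · simp only [pathConcat, h, if_false]; exact measurable_pi_apply _

variable [DiscreteMeasurableSpace S]

theorem measurableSet_pathCylinder (n : ℕ) (x : ℕ → S) : MeasurableSet (pathCylinder n x) := by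
  have : pathCylinder n x = ⋂ t, ⋂ (_ : t ≤ n), (fun w : ℕ → S => w t) ⁻¹' {x t} := by
    ext w; simp [pathCylinder]
  rw [this]
  exact MeasurableSet.iInter fun t => MeasurableSet.iInter fun _ =>
    measurable_pi_apply t (measurableSet_singleton _)

variable [Countable S]

/-- Finite measures on the path space of a countable set are determined by the cylinders. -/
theorem Measure.ext_of_pathCylinder {μ ν : Measure (ℕ → S)} [IsFiniteMeasure μ]
    (h : ∀ n x, μ (pathCylinder n x) = ν (pathCylinder n x)) : μ = ν := by
  classical
  -- A projective limit is unique, and it suffices to compare marginals on the initial segments `Iic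
  -- n`, whose points pull back to cylinders.
  have hν : IsProjectiveLimit ν (fun I : Finset ℕ => μ.map I.restrict) := by
    rw [isProjectiveLimit_nat_iff]
    · intro n
      refine Measure.ext_of_singleton fun a => ?_
      rw [Measure.map_apply (by fun_prop) (measurableSet_singleton _),
        Measure.map_apply (by fun_prop) (measurableSet_singleton _)]
      rcases isEmpty_or_nonempty S with hS | ⟨⟨s⟩⟩
      · exact (IsEmpty.false (a ⟨0, by simp⟩)).elim
      have : (Finset.Iic n).restrict (π := fun _ => S) ⁻¹' {a}
          = pathCylinder n (fun t => if ht : t ∈ Finset.Iic n then a ⟨t, ht⟩ else s) := by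
        ext w
        simp only [Set.mem_preimage, Set.mem_singleton_iff, funext_iff, Finset.restrict,
          Subtype.forall, pathCylinder, Set.mem_ofPred_eq]
        refine forall_congr' fun t => ⟨fun h1 ht => ?_, fun h1 ht => ?_⟩
        · rw [dif_pos (Finset.mem_Iic.2 ht)]; exact h1 _
        · have := h1 (Finset.mem_Iic.1 ht)
          rwa [dif_pos ht] at this
      change ν ((Finset.Iic n).restrict (π := fun _ => S) ⁻¹' {a}) = _
      rw [this]
      exact (h _ _).symm
    · intro I J hJI
      exact (Measure.map_map (Finset.measurable_restrict₂ (X := fun _ => S) hJI)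
        (Finset.measurable_restrict (X := fun _ => S) I)).symm
  exact IsProjectiveLimit.unique (P := fun I : Finset ℕ => μ.map I.restrict) (fun I => rfl) hν

end Paths

/-! ### The Markov property in terms of cylinders -/

section Markov

variable {S : Type*} [MeasurableSpace S] [DiscreteMeasurableSpace S] [Countable S]

/-- Two Markov paths with the same end point have proportional laws of the future. -/
theorem smul_map_pathTail_comm {μ : Measure (ℕ → S)} [IsFiniteMeasure μ] {α : PMF S}
    {P : ℕ → S → PMF S}
    (hμ : ∀ n x, μ (pathCylinder n x) = α (x 0) * ∏ t ∈ Finset.range n, P t (x t) (x (t + 1)))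
    {n : ℕ} {x x' : ℕ → S} (h : x n = x' n) :
    μ (pathCylinder n x') • (μ.restrict (pathCylinder n x)).map (pathTail n)
      = μ (pathCylinder n x) • (μ.restrict (pathCylinder n x')).map (pathTail n) := by
  have hfin (s) : IsFiniteMeasure (μ s • (μ.restrict (pathCylinder n x)).map (pathTail n)) :=
    Measure.smul_finite _ (measure_ne_top _ _)
  refine Measure.ext_of_pathCylinder fun m y => ?_
  simp only [Measure.smul_apply, smul_eq_mul]
  have key (z : ℕ → S) : (μ.restrict (pathCylinder n z)).map (pathTail n) (pathCylinder m y)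
      = μ (pathTail n ⁻¹' pathCylinder m y ∩ pathCylinder n z) := by
    rw [Measure.map_apply (measurable_pathTail n) (measurableSet_pathCylinder _ _),
      Measure.restrict_apply (measurable_pathTail n (measurableSet_pathCylinder _ _))]
  rw [key, key]
  by_cases hy : y 0 = x n
  -- The factor contributed by the future involves `y` alone, so it is the same for `x` and `x'`.
  · have split (z : ℕ → S) (hz : y 0 = z n) :
        μ (pathCylinder (n + m) (pathConcat n z y))
          = μ (pathCylinder n z) * ∏ t ∈ Finset.range m, P (n + t) (y t) (y (t + 1)) := by
      have hc : ∀ t ≤ n, pathConcat n z y t = z t := fun t ht => by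
        rcases ht.lt_or_eq with ht | rfl
        · exact pathConcat_of_lt _ _ ht
        · simpa [hz] using pathConcat_add t 0 z y
      rw [hμ, hμ, Finset.prod_range_add, hc 0 (Nat.zero_le _), mul_assoc]
      congr 2
      · refine Finset.prod_congr rfl fun t ht => ?_
        have := Finset.mem_range.1 ht
        rw [hc t this.le, hc (t + 1) this]
      · refine Finset.prod_congr rfl fun t _ => ?_
        rw [pathConcat_add, add_assoc, pathConcat_add]
    rw [pathTail_preimage_pathCylinder_inter hy, pathTail_preimage_pathCylinder_inter (hy.trans h),
      split x hy, split x' (hy.trans h)]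
    ring
  · rw [pathTail_preimage_pathCylinder_inter_eq_empty hy,
      pathTail_preimage_pathCylinder_inter_eq_empty (h ▸ hy)]
    simp

/-- The Markov property: given the past, the law of the future depends only on the present. -/
theorem exists_map_pathTail_eq_smul {μ : Measure (ℕ → S)} [IsFiniteMeasure μ] {α : PMF S}
    {P : ℕ → S → PMF S}
    (hμ : ∀ n x, μ (pathCylinder n x) = α (x 0) * ∏ t ∈ Finset.range n, P t (x t) (x (t + 1)))
    (n : ℕ) :
    ∃ ρ : S → Measure (ℕ → S), (∀ s, IsFiniteMeasure (ρ s)) ∧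
      ∀ x, (μ.restrict (pathCylinder n x)).map (pathTail n) = μ (pathCylinder n x) • ρ (x n) := by
  classical
  have (s : S) : ∃ ρ : Measure (ℕ → S), IsFiniteMeasure ρ ∧ ∀ x : ℕ → S, x n = s →
      (μ.restrict (pathCylinder n x)).map (pathTail n) = μ (pathCylinder n x) • ρ := by
    -- Any past of positive probability ending at `s` serves to define the conditional law of the
    -- future; a state never reached gets the zero measure.
    by_cases hs : ∃ x : ℕ → S, x n = s ∧ μ (pathCylinder n x) ≠ 0
    · obtain ⟨x', hx's, hx'⟩ := hs
      refine ⟨(μ (pathCylinder n x'))⁻¹ • (μ.restrict (pathCylinder n x')).map (pathTail n),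
        Measure.smul_finite _ (ENNReal.inv_ne_top.2 hx'), fun x hx => ?_⟩
      rw [smul_comm, ← smul_map_pathTail_comm hμ (hx.trans hx's.symm), smul_smul,
        ENNReal.inv_mul_cancel hx' (measure_ne_top _ _), one_smul]
    · push Not at hs
      refine ⟨0, inferInstance, fun x hx => ?_⟩
      rw [Measure.restrict_eq_zero.2 (hs x hx)]
      simp
  choose ρ hρ h using this
  exact ⟨ρ, hρ, fun x => h _ x rfl⟩

/-- A criterion for the Markov property in terms of the finite-dimensional laws. -/
theorem isMarkovChain_of_mul_comm {Ω : Type*} [MeasurableSpace Ω] {μ : Measure Ω}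
    [IsProbabilityMeasure μ] {W : ℕ → Ω → S} (hW : ∀ t, Measurable (W t))
    (h : ∀ (n : ℕ) (w w' : ℕ → S), w n = w' n → w (n + 1) = w' (n + 1) →
      μ {ω | ∀ t ≤ n + 1, W t ω = w t} * μ {ω | ∀ t ≤ n, W t ω = w' t}
        = μ {ω | ∀ t ≤ n + 1, W t ω = w' t} * μ {ω | ∀ t ≤ n, W t ω = w t}) :
    IsMarkovChain μ W := by
  classical
  have meas (n : ℕ) (w : ℕ → S) : MeasurableSet {ω | ∀ t ≤ n, W t ω = w t} :=
    (measurable_pi_lambda (trajectory W) hW) (measurableSet_pathCylinder n w)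
  have succ (n : ℕ) (w : ℕ → S) : {ω | ∀ t ≤ n + 1, W t ω = w t}
      = {ω | ∀ t ≤ n, W t ω = w t} ∩ W (n + 1) ⁻¹' {w (n + 1)} := by
    ext ω
    simp only [Set.mem_inter_iff, Set.mem_preimage, Set.mem_ofPred_eq, Set.mem_singleton_iff]
    refine ⟨fun h => ⟨fun t ht => h t (by omega), h _ le_rfl⟩, fun h t ht => ?_⟩
    rcases Nat.le_succ_iff.1 ht with ht | rfl
    exacts [h.1 t ht, h.2]
  have step (n : ℕ) (s : S) : ∃ p : PMF S, ∀ w : ℕ → S, w n = s →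
      μ {ω | ∀ t ≤ n + 1, W t ω = w t} = μ {ω | ∀ t ≤ n, W t ω = w t} * p (w (n + 1)) := by
    by_cases hs : ∃ w : ℕ → S, w n = s ∧ μ {ω | ∀ t ≤ n, W t ω = w t} ≠ 0
    · obtain ⟨w', hw's, hw'⟩ := hs
      have := cond_isProbabilityMeasure hw'
      have := Measure.isProbabilityMeasure_map
        (μ := cond μ {ω | ∀ t ≤ n, W t ω = w' t}) (hW (n + 1)).aemeasurable
      refine ⟨((cond μ {ω | ∀ t ≤ n, W t ω = w' t}).map (W (n + 1))).toPMF, fun w hw => ?_⟩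
      rw [Measure.toPMF_apply, Measure.map_apply (hW _) (measurableSet_singleton _),
        cond_apply (meas n w')]
      -- The hybrid path has the reference past `w'` and the next state of `w`, so the hypothesis
      -- transfers the transition probability from one past to the other.
      have e := h n w (fun t => if t ≤ n then w' t else w t) (by simp [hw, hw's]) (by simp)
      have e1 : {ω | ∀ t ≤ n, W t ω = if t ≤ n then w' t else w t}
          = {ω | ∀ t ≤ n, W t ω = w' t} := by
        ext ω; exact forall₂_congr fun t ht => by rw [if_pos ht]
      rw [e1, succ n (fun t => if t ≤ n then w' t else w t), e1] at e
      simp only [add_le_iff_nonpos_right, nonpos_iff_eq_zero, one_ne_zero, if_false] at e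
      rw [mul_left_comm, mul_comm (μ {ω | ∀ t ≤ n, W t ω = w t}), ← e, mul_comm, mul_assoc,
        ENNReal.mul_inv_cancel hw' (measure_ne_top _ _), mul_one]
    · push Not at hs
      -- The state `s` has probability zero at time `n`, so its row is arbitrary.
      refine ⟨PMF.pure s, fun w hw => ?_⟩
      rw [hs w hw, zero_mul]
      exact measure_mono_null (succ n w ▸ Set.inter_subset_left) (hs w hw)
  choose P hP using step
  have := Measure.isProbabilityMeasure_map (μ := μ) (hW 0).aemeasurable
  refine ⟨(μ.map (W 0)).toPMF, P, hW, fun n x => ?_⟩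
  induction n with
  | zero =>
    rw [Measure.toPMF_apply, Measure.map_apply (hW _) (measurableSet_singleton _)]
    simp [Set.preimage]
  | succ n ih => rw [hP n _ x rfl, ih, Finset.prod_range_succ, mul_assoc]

end Markov

/-! ### The relatively independent coupling over a common image -/

section RelativeProduct

variable {𝓐 : Type u} {𝓑 : Type v} {𝓒 : Type w} [MeasurableSpace 𝓐] [MeasurableSpace 𝓑]
  [MeasurableSpace 𝓒] [StandardBorelSpace 𝓐] [Nonempty 𝓐] [StandardBorelSpace 𝓑] [Nonempty 𝓑]
  {P : Measure 𝓐} {P' : Measure 𝓑} {F : 𝓐 → 𝓒} {G : 𝓑 → 𝓒}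

theorem condDistrib_eq_of_map_eq {Ω Ω' : Type*} [MeasurableSpace Ω] [MeasurableSpace Ω']
    {μ : Measure Ω} {μ' : Measure Ω'} [IsFiniteMeasure μ] [IsFiniteMeasure μ']
    {X : Ω → 𝓐} {Z : Ω → 𝓒} {X' : Ω' → 𝓐} {Z' : Ω' → 𝓒}
    (h : μ.map (fun ω => (Z ω, X ω)) = μ'.map fun ω => (Z' ω, X' ω)) :
    condDistrib X Z μ = condDistrib X' Z' μ' := by
  simp only [condDistrib_def, h]

/-- The joint law of `x`, `y` and the common value `z = F x = G y`, where `x` and `y` are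
conditionally independent given `z`. -/
noncomputable def relativeTriple (P : Measure 𝓐) (P' : Measure 𝓑) [IsFiniteMeasure P]
    [IsFiniteMeasure P'] (F : 𝓐 → 𝓒) (G : 𝓑 → 𝓒) : Measure (𝓒 × 𝓐 × 𝓑) :=
  (Kernel.id ×ₖ (condDistrib id F P ×ₖ condDistrib id G P')) ∘ₘ P.map F

/-- The relatively independent coupling of `P` and `P'` over their common image. -/
noncomputable def relativeProduct (P : Measure 𝓐) (P' : Measure 𝓑) [IsFiniteMeasure P]
    [IsFiniteMeasure P'] (F : 𝓐 → 𝓒) (G : 𝓑 → 𝓒) : Measure (𝓐 × 𝓑) :=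
  (relativeTriple P P' F G).map Prod.snd

variable [IsProbabilityMeasure P] [IsProbabilityMeasure P']

theorem setLIntegral_condDistrib_id (hF : Measurable F) {B : Set 𝓒} (hB : MeasurableSet B)
    {S : Set 𝓐} (hS : MeasurableSet S) :
    ∫⁻ z in B, condDistrib id F P z S ∂(P.map F) = P (F ⁻¹' B ∩ S) := by
  rw [← Measure.compProd_apply_prod hB hS, compProd_map_condDistrib aemeasurable_id,
    Measure.map_apply (hF.prodMk measurable_id) (hB.prod hS)]
  rfl

/-- The joint law of `(F x, x)` is carried by the graph of `F`; disintegrating over the first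
coordinate puts almost every conditional law on its own fibre. -/
theorem ae_condDistrib_id [MeasurableEq 𝓒] (hF : Measurable F) :
    ∀ᵐ z ∂(P.map F), ∀ᵐ x ∂(condDistrib id F P z), F x = z := by
  refine Measure.ae_ae_of_ae_compProd (p := fun q : 𝓒 × 𝓐 => F q.2 = q.1) ?_
  have m : MeasurableSet {q : 𝓒 × 𝓐 | F q.2 = q.1} :=
    measurableSet_eq_fun (hF.comp measurable_snd) measurable_fst
  rw [compProd_map_condDistrib aemeasurable_id]
  refine (ae_map_iff (hF.prodMk measurable_id).aemeasurable m).2 ?_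
  exact Filter.Eventually.of_forall fun x => rfl

theorem relativeTriple_apply_prod {B : Set 𝓒} (hB : MeasurableSet B)
    {S : Set 𝓐} (hS : MeasurableSet S) {T : Set 𝓑} (hT : MeasurableSet T) :
    relativeTriple P P' F G (B ×ˢ S ×ˢ T)
      = ∫⁻ z in B, condDistrib id F P z S * condDistrib id G P' z T ∂(P.map F) := by
  rw [relativeTriple, Measure.bind_apply (hB.prod (hS.prod hT)) (Kernel.aemeasurable _),
    ← lintegral_indicator hB]
  refine lintegral_congr fun z => ?_
  rw [Kernel.prod_apply_prod, Kernel.prod_apply_prod, Kernel.id_apply, Measure.dirac_apply' _ hB]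
  by_cases hz : z ∈ B <;> simp [hz]

theorem relativeProduct_apply_prod {S : Set 𝓐} (hS : MeasurableSet S)
    {T : Set 𝓑} (hT : MeasurableSet T) :
    relativeProduct P P' F G (S ×ˢ T)
      = ∫⁻ z, condDistrib id F P z S * condDistrib id G P' z T ∂(P.map F) := by
  have := relativeTriple_apply_prod (P := P) (P' := P') (F := F) (G := G) MeasurableSet.univ hS hT
  rw [setLIntegral_univ] at this
  rw [relativeProduct, Measure.map_apply measurable_snd (hS.prod hT), ← this]
  congr 1
  ext q
  simp

theorem map_fst_relativeProduct (hF : Measurable F) :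
    (relativeProduct P P' F G).map Prod.fst = P := by
  ext S hS
  rw [Measure.map_apply measurable_fst hS, ← Set.prod_univ,
    relativeProduct_apply_prod hS MeasurableSet.univ]
  simp only [measure_univ, mul_one]
  rw [← setLIntegral_univ, setLIntegral_condDistrib_id hF MeasurableSet.univ hS]
  simp

theorem map_snd_relativeProduct (hG : Measurable G)
    (h : P.map F = P'.map G) : (relativeProduct P P' F G).map Prod.snd = P' := by
  ext S hS
  rw [Measure.map_apply measurable_snd hS, ← Set.univ_prod,
    relativeProduct_apply_prod MeasurableSet.univ hS, h]
  simp only [measure_univ, one_mul]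
  rw [← setLIntegral_univ, setLIntegral_condDistrib_id hG MeasurableSet.univ hS]
  simp

theorem ae_relativeTriple [MeasurableEq 𝓒] (hF : Measurable F) (hG : Measurable G)
    (h : P.map F = P'.map G) :
    ∀ᵐ q ∂(relativeTriple P P' F G), F q.2.1 = q.1 ∧ G q.2.2 = q.1 := by
  have m1 : MeasurableSet {q : 𝓒 × 𝓐 × 𝓑 | F q.2.1 = q.1} :=
    measurableSet_eq_fun (by fun_prop) measurable_fst
  have m2 : MeasurableSet {q : 𝓒 × 𝓐 × 𝓑 | G q.2.2 = q.1} :=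
    measurableSet_eq_fun (by fun_prop) measurable_fst
  have m : MeasurableSet {q : 𝓒 × 𝓐 × 𝓑 | F q.2.1 = q.1 ∧ G q.2.2 = q.1} := m1.inter m2
  refine (Measure.ae_comp_iff m).2 ?_
  have hG' := ae_condDistrib_id (P := P') hG
  rw [← h] at hG'
  filter_upwards [ae_condDistrib_id (P := P) hF, hG'] with z h1 h2
  rw [Kernel.prod_apply, Kernel.prod_apply, Kernel.id_apply, Measure.dirac_prod]
  refine (ae_map_iff measurable_prodMk_left.aemeasurable m).2 ?_
  exact (Measure.quasiMeasurePreserving_fst.ae h1).and (Measure.quasiMeasurePreserving_snd.ae h2)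

/-- The first coordinate of the triple is almost surely a function of the second, so forgetting it
loses nothing. This returns from the pair to the form in which conditional independence is visible.
-/
theorem map_relativeProduct [MeasurableEq 𝓒] (hF : Measurable F) (hG : Measurable G)
    (h : P.map F = P'.map G) :
    (relativeProduct P P' F G).map (fun p => (F p.1, p.1, p.2)) = relativeTriple P P' F G := by
  rw [relativeProduct, Measure.map_map (by fun_prop) measurable_snd]
  conv_rhs => rw [← Measure.map_id (μ := relativeTriple P P' F G)]
  refine Measure.map_congr ?_
  filter_upwards [ae_relativeTriple hF hG h] with q hq
  simp only [Function.comp, hq.1, id]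

theorem ae_relativeProduct [MeasurableEq 𝓒] (hF : Measurable F) (hG : Measurable G)
    (h : P.map F = P'.map G) : ∀ᵐ p ∂(relativeProduct P P' F G), F p.1 = G p.2 := by
  rw [relativeProduct, ae_map_iff measurable_snd.aemeasurable
    (measurableSet_eq_fun (by fun_prop) (by fun_prop))]
  filter_upwards [ae_relativeTriple hF hG h] with q hq
  rw [hq.1, hq.2]

/-- The relatively independent coupling, realised on the fibre product. -/
theorem exists_measure_fiberProduct [MeasurableEq 𝓒] (hF : Measurable F) (hG : Measurable G)
    (h : P.map F = P'.map G) :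
    ∃ (_ : StandardBorelSpace {p : 𝓐 × 𝓑 // F p.1 = G p.2})
      (μ : Measure {p : 𝓐 × 𝓑 // F p.1 = G p.2}) (_ : IsProbabilityMeasure μ),
      μ.map Subtype.val = relativeProduct P P' F G ∧
      ∃ hm : MeasurableSpace.comap (fun ω : {p : 𝓐 × 𝓑 // F p.1 = G p.2} => F ω.1.1) inferInstance
          ≤ (inferInstance : MeasurableSpace {p : 𝓐 × 𝓑 // F p.1 = G p.2}),
        CondIndepFun (MeasurableSpace.comap (fun ω : {p : 𝓐 × 𝓑 // F p.1 = G p.2} => F ω.1.1)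
          inferInstance) hm (fun ω => ω.1.1) (fun ω => ω.1.2) μ := by
  -- Passing from the product to the fibre product turns the almost sure equality of images into one
  -- valid at every point; measurability of this set keeps the space standard Borel.
  have hD : MeasurableSet {p : 𝓐 × 𝓑 | F p.1 = G p.2} :=
    measurableSet_eq_fun (by fun_prop) (by fun_prop)
  have hsb : StandardBorelSpace {p : 𝓐 × 𝓑 // F p.1 = G p.2} := hD.standardBorel
  let μ : Measure {p : 𝓐 × 𝓑 // F p.1 = G p.2} :=
    (relativeProduct P P' F G).comap Subtype.val
  have hμ : μ.map Subtype.val = relativeProduct P P' F G :=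
    (map_comap_subtype_coe hD _).trans
      (Measure.restrict_eq_self_of_ae_mem (ae_relativeProduct hF hG h))
  have hμ1 : μ.map (fun ω => ω.1.1) = P := by
    refine Eq.trans ?_ (map_fst_relativeProduct (P' := P') (G := G) hF)
    rw [← hμ, Measure.map_map measurable_fst measurable_subtype_coe]
    rfl
  have hμ2 : μ.map (fun ω => ω.1.2) = P' := by
    refine Eq.trans ?_ (map_snd_relativeProduct hG h)
    rw [← hμ, Measure.map_map measurable_snd measurable_subtype_coe]
    rfl
  have hprob : IsProbabilityMeasure μ := by
    have : IsProbabilityMeasure (μ.map (fun ω => ω.1.1)) := hμ1 ▸ inferInstance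
    exact Measure.isProbabilityMeasure_of_map (fun ω => ω.1.1)
  have mX : Measurable fun ω : {p : 𝓐 × 𝓑 // F p.1 = G p.2} => ω.1.1 := by fun_prop
  have mY : Measurable fun ω : {p : 𝓐 × 𝓑 // F p.1 = G p.2} => ω.1.2 := by fun_prop
  have mZ : Measurable fun ω : {p : 𝓐 × 𝓑 // F p.1 = G p.2} => F ω.1.1 := by fun_prop
  refine ⟨hsb, μ, hprob, hμ, mZ.comap_le, ?_⟩
  rw [condIndepFun_iff_map_prod_eq_prod_condDistrib_prod_condDistrib mX mY mZ]
  have e1 : condDistrib (fun ω => ω.1.1) (fun ω => F ω.1.1) μ = condDistrib id F P := by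
    refine condDistrib_eq_of_map_eq ?_
    rw [← hμ1, Measure.map_map (by fun_prop) mX]
    rfl
  have e2 : condDistrib (fun ω => ω.1.2) (fun ω => F ω.1.1) μ = condDistrib id G P' := by
    refine condDistrib_eq_of_map_eq ?_
    rw [← hμ2, Measure.map_map (by fun_prop) mY]
    congr 1
    funext ω
    simp [ω.2]
  have e3 : μ.map (fun ω => F ω.1.1) = P.map F := by
    rw [← hμ1, Measure.map_map hF mX]; rfl
  rw [e1, e2, e3]
  change _ = relativeTriple P P' F G
  rw [← map_relativeProduct hF hG h, ← hμ, Measure.map_map (by fun_prop) measurable_subtype_coe]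
  rfl

end RelativeProduct

/-! ### Cylinder probabilities of the coupling of two Markov chains -/

/-- The map on path spaces induced by a map of state spaces. -/
def pathMap {S T : Type*} (f : S → T) (x : ℕ → S) : ℕ → T := fun t => f (x t)

theorem measurable_pathMap {S T : Type*} [MeasurableSpace S] [DiscreteMeasurableSpace S]
    [MeasurableSpace T] (f : S → T) : Measurable (pathMap f) :=
  measurable_pi_lambda _ fun t => (Measurable.of_discrete (f := f)).comp (measurable_pi_apply t)

section MarkovCoupling

variable {A : Type u} {B : Type v} {C : Type w}
  [Countable A] [MeasurableSpace A] [DiscreteMeasurableSpace A]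
  [Countable B] [MeasurableSpace B] [DiscreteMeasurableSpace B]
  [MeasurableSpace C] [DiscreteMeasurableSpace C]

/-- On the cylinder of `x`, the conditional probability of that cylinder given the image path
factorises into the probabilities of the past and a function of the present state and of the
future of the image path. -/
theorem exists_condDistrib_pathCylinder [Nonempty A] {P : Measure (ℕ → A)} [IsProbabilityMeasure P]
    {α : PMF A} {p : ℕ → A → PMF A}
    (hP : ∀ n x, P (pathCylinder n x) = α (x 0) * ∏ t ∈ Finset.range n, p t (x t) (x (t + 1)))
    (f : A → C) {n : ℕ} {ρ : C → Measure (ℕ → C)} (hρ : ∀ c, IsFiniteMeasure (ρ c))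
    (h : ∀ z, ((P.map (pathMap f)).restrict (pathCylinder n z)).map (pathTail n)
      = P.map (pathMap f) (pathCylinder n z) • ρ (z n)) :
    ∃ φ : A → (ℕ → C) → ℝ≥0∞, (∀ a, Measurable (φ a)) ∧ ∀ x,
      ∀ᵐ ζ ∂ρ (f (x n)), P.map (pathMap f) (pathCylinder n (pathMap f x)) *
          condDistrib id (pathMap f) P (pathConcat n (pathMap f x) ζ) (pathCylinder n x)
        = P (pathCylinder n x) * φ (x n) ζ := by
  have mf := measurable_pathMap f
  obtain ⟨lam, hlam, hl⟩ := exists_map_pathTail_eq_smul hP n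
  -- `φ a` is the density of the image of the future from state `a` with respect to the future of
  -- the image chain from `f a`; it does not involve the past of `x`.
  refine ⟨fun a => ((lam a).map (pathMap f)).rnDeriv (ρ (f a)),
    fun a => Measure.measurable_rnDeriv _ _, fun x => ?_⟩
  set z := pathMap f x with hz
  set k : (ℕ → C) → ℝ≥0∞ := fun ζ =>
    condDistrib id (pathMap f) P (pathConcat n z ζ) (pathCylinder n x) with hk
  have mk : Measurable k :=
    (Kernel.measurable_coe _ (measurableSet_pathCylinder n x)).comp (measurable_pathConcat n z)
  have hsub : pathCylinder n x ⊆ pathMap f ⁻¹' pathCylinder n z :=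
    fun w hw t ht => congrArg f (hw t ht)
  -- Bayes' rule: both sides are the joint measure of the event `pathCylinder n x` and the future of
  -- the image path, computed by conditioning on the image or on `x n`.
  have key : (ρ (z n)).withDensity (P.map (pathMap f) (pathCylinder n z) • k)
      = P (pathCylinder n x) • (lam (x n)).map (pathMap f) := by
    rw [withDensity_smul _ mk, ← withDensity_smul_measure, ← h, ← Measure.map_smul, ← hl]
    ext D hD
    have hD' := measurable_pathTail n hD
    rw [withDensity_apply _ hD, setLIntegral_map hD mk (measurable_pathTail n),
      Measure.restrict_restrict hD', Measure.map_map mf (measurable_pathTail n),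
      Measure.map_apply (mf.comp (measurable_pathTail n)) hD,
      Measure.restrict_apply ((mf.comp (measurable_pathTail n)) hD)]
    have e : ∫⁻ w in pathTail n ⁻¹' D ∩ pathCylinder n z, k (pathTail n w) ∂(P.map (pathMap f))
        = ∫⁻ w in pathTail n ⁻¹' D ∩ pathCylinder n z,
          condDistrib id (pathMap f) P w (pathCylinder n x) ∂(P.map (pathMap f)) := by
      refine setLIntegral_congr_fun (hD'.inter (measurableSet_pathCylinder n z)) fun w hw => ?_
      simp only [hk, pathConcat_pathTail hw.2]
    rw [e, setLIntegral_condDistrib_id mf (hD'.inter (measurableSet_pathCylinder n z))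
      (measurableSet_pathCylinder n x), Set.preimage_inter, Set.inter_assoc,
      Set.inter_eq_self_of_subset_right hsub]
    rfl
  -- Comparing densities with respect to `ρ (z n)` needs no absolute continuity assumption on `lam
  -- (x n)`: if `P (pathCylinder n x) = 0`, both sides vanish almost everywhere.
  have h1 := Measure.rnDeriv_withDensity (ρ (z n))
    (mk.const_smul (P.map (pathMap f) (pathCylinder n z)))
  rw [key] at h1
  have h2 := Measure.rnDeriv_smul_left_of_ne_top ((lam (x n)).map (pathMap f)) (ρ (z n))
    (measure_ne_top P (pathCylinder n x))
  filter_upwards [h1, h2] with ζ h1 h2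
  exact h1.symm.trans h2

variable [Countable C]

/-- The finite-dimensional laws of the relatively independent coupling of two Markov chains over
a common Markov image are, up to normalisation, products of those of the two chains and a
function of the present state. -/
theorem exists_relativeProduct_pathCylinder [Nonempty A] [Nonempty B]
    {P : Measure (ℕ → A)} [IsProbabilityMeasure P] {α : PMF A} {p : ℕ → A → PMF A}
    (hP : ∀ n x, P (pathCylinder n x) = α (x 0) * ∏ t ∈ Finset.range n, p t (x t) (x (t + 1)))
    {P' : Measure (ℕ → B)} [IsProbabilityMeasure P'] {β : PMF B} {q : ℕ → B → PMF B}
    (hP' : ∀ n x, P' (pathCylinder n x) = β (x 0) * ∏ t ∈ Finset.range n, q t (x t) (x (t + 1)))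
    {f : A → C} {g : B → C} {γ : PMF C} {r : ℕ → C → PMF C}
    (hν : ∀ n x, P.map (pathMap f) (pathCylinder n x)
      = γ (x 0) * ∏ t ∈ Finset.range n, r t (x t) (x (t + 1)))
    (h : P.map (pathMap f) = P'.map (pathMap g)) (n : ℕ) :
    ∃ H : A → B → ℝ≥0∞, ∀ (x : ℕ → A) (y : ℕ → B), (∀ t ≤ n, f (x t) = g (y t)) →
      P.map (pathMap f) (pathCylinder n (pathMap f x)) *
          relativeProduct P P' (pathMap f) (pathMap g) (pathCylinder n x ×ˢ pathCylinder n y)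
        = P (pathCylinder n x) * P' (pathCylinder n y) * H (x n) (y n) := by
  have mf := measurable_pathMap f
  have mg := measurable_pathMap g
  have := Measure.isProbabilityMeasure_map (μ := P) mf.aemeasurable
  obtain ⟨ρ, hρ, hr⟩ := exists_map_pathTail_eq_smul hν n
  obtain ⟨φ, mφ, hφ⟩ := exists_condDistrib_pathCylinder hP f hρ hr
  have hr' := hr
  rw [h] at hr'
  obtain ⟨ψ, mψ, hψ⟩ := exists_condDistrib_pathCylinder hP' g hρ hr'
  rw [← h] at hψ
  refine ⟨fun a b => ∫⁻ ζ, φ a ζ * ψ b ζ ∂ρ (f a), fun x y hxy => ?_⟩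
  have mx := measurableSet_pathCylinder n x
  have my := measurableSet_pathCylinder n y
  set z := pathMap f x with hz
  have mz := measurableSet_pathCylinder n z
  have hcyl : pathCylinder n (pathMap g y) = pathCylinder n z := by
    ext w; exact forall₂_congr fun t ht => by simp only [hz, pathMap, hxy t ht]
  have hcat (ζ) : pathConcat n (pathMap g y) ζ = pathConcat n z ζ := by
    funext t
    by_cases ht : t < n
    · simp only [pathConcat_of_lt _ _ ht, hz, pathMap, hxy t ht.le]
    · simp [pathConcat, ht]
  have hφx := hφ x
  have hψy := hψ y
  simp only [hcyl, hcat, ← hxy n le_rfl] at hψy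
  have hsub : pathCylinder n x ⊆ pathMap f ⁻¹' pathCylinder n z :=
    fun w hw t ht => congrArg f (hw t ht)
  set K := fun w => condDistrib id (pathMap f) P w (pathCylinder n x) with hK
  set K' := fun w => condDistrib id (pathMap g) P' w (pathCylinder n y) with hK'
  have mK : Measurable K := Kernel.measurable_coe _ mx
  have mK' : Measurable K' := Kernel.measurable_coe _ my
  have mKc : Measurable fun ζ => K (pathConcat n z ζ) := mK.comp (measurable_pathConcat n z)
  have mKc' : Measurable fun ζ => K' (pathConcat n z ζ) := mK'.comp (measurable_pathConcat n z)
  have mKK : Measurable fun ζ => K (pathConcat n z ζ) * K' (pathConcat n z ζ) := mKc.mul mKc'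
  have mφψ : Measurable fun ζ => φ (x n) ζ * ψ (y n) ζ := (mφ _).mul (mψ _)
  -- Paths in the cylinder of `x` have image in the cylinder of `z`, so other image paths contribute
  -- nothing.
  have hout : ∫⁻ w in (pathCylinder n z)ᶜ, K w * K' w ∂(P.map (pathMap f)) = 0 := by
    refine le_antisymm ?_ (zero_le)
    calc _ ≤ ∫⁻ w in (pathCylinder n z)ᶜ, K w ∂(P.map (pathMap f)) :=
          lintegral_mono fun w => mul_le_of_le_one_right' prob_le_one
      _ = 0 := by
        rw [setLIntegral_condDistrib_id mf mz.compl mx]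
        convert measure_empty (μ := P)
        ext w
        simp only [Set.mem_inter_iff, Set.mem_preimage, Set.mem_compl_iff,
          Set.mem_empty_iff_false, iff_false, not_and]
        exact fun hw hw' => hw (hsub hw')
  have hin : ∫⁻ w in pathCylinder n z, K w * K' w ∂(P.map (pathMap f))
      = P.map (pathMap f) (pathCylinder n z) *
        ∫⁻ ζ, K (pathConcat n z ζ) * K' (pathConcat n z ζ) ∂ρ (z n) := by
    rw [← smul_eq_mul, ← lintegral_smul_measure, ← hr,
      lintegral_map mKK (measurable_pathTail n)]
    refine setLIntegral_congr_fun mz fun w hw => ?_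
    simp only [pathConcat_pathTail hw]
  rw [relativeProduct_apply_prod mx my, ← lintegral_add_compl _ mz, hout, add_zero, hin,
    ← mul_assoc, ← lintegral_const_mul _ mKK, ← lintegral_const_mul _ mφψ]
  refine lintegral_congr_ae ?_
  filter_upwards [hφx, hψy] with ζ h1 h2
  -- Of the two factors `ν(cyl z)`, one comes from the statement and one from `hin`; each normalises
  -- one conditional probability.
  calc _ = (P.map (pathMap f) (pathCylinder n z) * K (pathConcat n z ζ)) *
        (P.map (pathMap f) (pathCylinder n z) * K' (pathConcat n z ζ)) := by ring
    _ = _ := by rw [h1, h2]; ring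

/-- From the product formula at times `n` and `n + 1`, the one-step ratio is `p * q * H' / (r * H)`,
a function of the last two states only. The cross-multiplied form avoids dividing by zero. -/
theorem relativeProduct_pathCylinder_mul_comm [Nonempty A] [Nonempty B]
    {P : Measure (ℕ → A)} [IsProbabilityMeasure P] {α : PMF A} {p : ℕ → A → PMF A}
    (hP : ∀ n x, P (pathCylinder n x) = α (x 0) * ∏ t ∈ Finset.range n, p t (x t) (x (t + 1)))
    {P' : Measure (ℕ → B)} [IsProbabilityMeasure P'] {β : PMF B} {q : ℕ → B → PMF B}
    (hP' : ∀ n x, P' (pathCylinder n x) = β (x 0) * ∏ t ∈ Finset.range n, q t (x t) (x (t + 1)))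
    {f : A → C} {g : B → C} {γ : PMF C} {r : ℕ → C → PMF C}
    (hν : ∀ n x, P.map (pathMap f) (pathCylinder n x)
      = γ (x 0) * ∏ t ∈ Finset.range n, r t (x t) (x (t + 1)))
    (h : P.map (pathMap f) = P'.map (pathMap g)) {n : ℕ} {x x' : ℕ → A} {y y' : ℕ → B}
    (hx : x n = x' n) (hy : y n = y' n) (hx1 : x (n + 1) = x' (n + 1))
    (hy1 : y (n + 1) = y' (n + 1)) :
    relativeProduct P P' (pathMap f) (pathMap g)
          (pathCylinder (n + 1) x ×ˢ pathCylinder (n + 1) y) *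
        relativeProduct P P' (pathMap f) (pathMap g) (pathCylinder n x' ×ˢ pathCylinder n y')
      = relativeProduct P P' (pathMap f) (pathMap g)
          (pathCylinder (n + 1) x' ×ˢ pathCylinder (n + 1) y') *
        relativeProduct P P' (pathMap f) (pathMap g) (pathCylinder n x ×ˢ pathCylinder n y) := by
  have mf := measurable_pathMap f
  have mg := measurable_pathMap g
  have := Measure.isProbabilityMeasure_map (μ := P) mf.aemeasurable
  set Q := relativeProduct P P' (pathMap f) (pathMap g) with hQ
  set ν := P.map (pathMap f) with hν'
  have anti (x : ℕ → A) (y : ℕ → B) : Q (pathCylinder (n + 1) x ×ˢ pathCylinder (n + 1) y)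
      ≤ Q (pathCylinder n x ×ˢ pathCylinder n y) :=
    measure_mono (Set.prod_mono (pathCylinder_succ_subset n x) (pathCylinder_succ_subset n y))
  have incompat (m : ℕ) (x : ℕ → A) (y : ℕ → B) (hne : ¬ ∀ t ≤ m, f (x t) = g (y t)) :
      Q (pathCylinder m x ×ˢ pathCylinder m y) = 0 := by
    refine measure_mono_null ?_ (ae_iff.1 (ae_relativeProduct mf mg h))
    rintro ⟨a, b⟩ ⟨ha, hb⟩ hab
    exact hne fun t ht => by rw [← ha t ht, ← hb t ht]; exact congrFun hab t
  have le (m : ℕ) (x : ℕ → A) (y : ℕ → B) : Q (pathCylinder m x ×ˢ pathCylinder m y)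
      ≤ ν (pathCylinder m (pathMap f x)) := by
    calc _ ≤ Q (Prod.fst ⁻¹' pathCylinder m x) := measure_mono fun _ hq => hq.1
      _ = P (pathCylinder m x) := by
        rw [← Measure.map_apply measurable_fst (measurableSet_pathCylinder _ _), hQ,
          map_fst_relativeProduct mf]
      _ ≤ _ := by
        rw [hν', Measure.map_apply mf (measurableSet_pathCylinder _ _)]
        exact measure_mono fun w hw t ht => congrArg f (hw t ht)
  -- Degenerate cases make both sides zero. Otherwise, since `Q` is bounded by the image cylinder
  -- probability, `N` and `N'` are nonzero and can be cancelled.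
  by_cases c1 : Q (pathCylinder n x ×ˢ pathCylinder n y) = 0
  · rw [c1, le_zero_iff.1 ((anti x y).trans c1.le), zero_mul, mul_zero]
  by_cases c2 : Q (pathCylinder n x' ×ˢ pathCylinder n y') = 0
  · rw [c2, le_zero_iff.1 ((anti x' y').trans c2.le), zero_mul, mul_zero]
  have k1 : ∀ t ≤ n, f (x t) = g (y t) := by
    by_contra hne; exact c1 (incompat n x y hne)
  have k2 : ∀ t ≤ n, f (x' t) = g (y' t) := by
    by_contra hne; exact c2 (incompat n x' y' hne)
  by_cases c3 : f (x (n + 1)) = g (y (n + 1))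
  swap
  · rw [incompat (n + 1) x y fun h => c3 (h _ le_rfl),
      incompat (n + 1) x' y' fun h => c3 (by rw [hx1, hy1]; exact h _ le_rfl), zero_mul, zero_mul]
  have extend {x : ℕ → A} {y : ℕ → B} (k : ∀ t ≤ n, f (x t) = g (y t))
      (c : f (x (n + 1)) = g (y (n + 1))) : ∀ t ≤ n + 1, f (x t) = g (y t) := fun t ht => by
    rcases Nat.le_succ_iff.1 ht with ht | rfl
    exacts [k t ht, c]
  have n1 : ν (pathCylinder n (pathMap f x)) ≠ 0 := fun e =>
    c1 (le_zero_iff.1 ((le n x y).trans e.le))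
  have n2 : ν (pathCylinder n (pathMap f x')) ≠ 0 := fun e =>
    c2 (le_zero_iff.1 ((le n x' y').trans e.le))
  obtain ⟨H, hH⟩ := exists_relativeProduct_pathCylinder hP hP' hν h n
  obtain ⟨H', hH'⟩ := exists_relativeProduct_pathCylinder hP hP' hν h (n + 1)
  have a1 := hH x y k1
  have a2 := hH x' y' k2
  have b1 := hH' x y (extend k1 c3)
  have b2 := hH' x' y' (extend k2 (by rw [← hx1, ← hy1]; exact c3))
  have sP (x : ℕ → A) : P (pathCylinder (n + 1) x)
      = P (pathCylinder n x) * p n (x n) (x (n + 1)) := by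
    rw [hP, hP, Finset.prod_range_succ, mul_assoc]
  have sP' (x : ℕ → B) : P' (pathCylinder (n + 1) x)
      = P' (pathCylinder n x) * q n (x n) (x (n + 1)) := by
    rw [hP', hP', Finset.prod_range_succ, mul_assoc]
  have sν (x : ℕ → C) : ν (pathCylinder (n + 1) x)
      = ν (pathCylinder n x) * r n (x n) (x (n + 1)) := by
    rw [hν, hν, Finset.prod_range_succ, mul_assoc]
  set R := r n (f (x n)) (f (x (n + 1))) with hR
  have sν1 : ν (pathCylinder (n + 1) (pathMap f x)) = ν (pathCylinder n (pathMap f x)) * R := sν _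
  have sν2 : ν (pathCylinder (n + 1) (pathMap f x'))
      = ν (pathCylinder n (pathMap f x')) * R := by
    rw [sν, hR, hx, hx1]; rfl
  by_cases n3 : R = 0
  · rw [n3, mul_zero] at sν1 sν2
    rw [le_zero_iff.1 ((le (n + 1) x y).trans sν1.le),
      le_zero_iff.1 ((le (n + 1) x' y').trans sν2.le), zero_mul, zero_mul]
  rw [sν1, sP, sP'] at b1
  rw [sν2, sP, sP', ← hx, ← hy, ← hx1, ← hy1] at b2
  rw [← hx, ← hy] at a2
  set N := ν (pathCylinder n (pathMap f x))
  set N' := ν (pathCylinder n (pathMap f x'))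
  have hN : N * N' * R ≠ 0 := mul_ne_zero (mul_ne_zero n1 n2) n3
  have hN' : N * N' * R ≠ ∞ := ENNReal.mul_ne_top
    (ENNReal.mul_ne_top (measure_ne_top _ _) (measure_ne_top _ _)) (PMF.apply_ne_top _ _)
  rw [← ENNReal.mul_right_inj hN hN']
  calc _ = (N * R * Q (pathCylinder (n + 1) x ×ˢ pathCylinder (n + 1) y)) *
        (N' * Q (pathCylinder n x' ×ˢ pathCylinder n y')) := by ring
    _ = (N' * R * Q (pathCylinder (n + 1) x' ×ˢ pathCylinder (n + 1) y')) *
        (N * Q (pathCylinder n x ×ˢ pathCylinder n y)) := by rw [a1, a2, b1, b2]; ring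
    _ = _ := by ring

end MarkovCoupling

/-! ### Assembly on the fibre product of the path spaces -/

theorem IsMC.map_trajectory_pathCylinder {Ω : Type*} [MeasurableSpace Ω] {S : Type*}
    [MeasurableSpace S] [DiscreteMeasurableSpace S] {μ : Measure Ω} {X : ℕ → Ω → S} {α : PMF S}
    {P : ℕ → S → PMF S} (h : IsMC μ X α P) (n : ℕ) (x : ℕ → S) :
    μ.map (trajectory X) (pathCylinder n x)
      = α (x 0) * ∏ t ∈ Finset.range n, P t (x t) (x (t + 1)) := by
  rw [Measure.map_apply (measurable_pi_lambda (trajectory X) h.measurable) (measurableSet_pathCylinder n x)]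
  exact h.law n x

theorem mainTheorem6
    {A : Type u} {B : Type v} {C : Type w}
    [Countable A] [MeasurableSpace A] [DiscreteMeasurableSpace A]
    [Countable B] [MeasurableSpace B] [DiscreteMeasurableSpace B]
    [Countable C] [MeasurableSpace C] [DiscreteMeasurableSpace C]
    {ΩX : Type u'} {ΩY : Type v'} {ΩZ : Type w'}
    [MeasurableSpace ΩX] [MeasurableSpace ΩY] [MeasurableSpace ΩZ]
    (μX : Measure ΩX) (μY : Measure ΩY) (μZ : Measure ΩZ)
    [IsProbabilityMeasure μX] [IsProbabilityMeasure μY] [IsProbabilityMeasure μZ]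
    (Xbar : ℕ → ΩX → A) (Ybar : ℕ → ΩY → B) (Zbar : ℕ → ΩZ → C)
    (hX : IsMarkovChain μX Xbar) (hY : IsMarkovChain μY Ybar) (hZ : IsMarkovChain μZ Zbar)
    (f : A → C) (g : B → C)
    (hf : IdentDistrib (trajectory (imageProcess f Xbar)) (trajectory Zbar) μX μZ)
    (hg : IdentDistrib (trajectory Zbar) (trajectory (imageProcess g Ybar)) μZ μY) :
    ∃ (Ω : Type (max u v)) (_ : MeasurableSpace Ω) (_ : StandardBorelSpace Ω)
      (μ : Measure Ω) (_ : IsProbabilityMeasure μ) (X : ℕ → Ω → A) (Y : ℕ → Ω → B),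
      IsMarkovChain μ (fun t ω => (X t ω, Y t ω)) ∧
      IdentDistrib (trajectory X) (trajectory Xbar) μ μX ∧
      IdentDistrib (trajectory Y) (trajectory Ybar) μ μY ∧
      (∀ t ω, f (X t ω) = g (Y t ω)) ∧
      IdentDistrib (trajectory (imageProcess f X)) (trajectory Zbar) μ μZ ∧
      ∃ hm : MeasurableSpace.comap (trajectory (imageProcess f X)) inferInstance
          ≤ (inferInstance : MeasurableSpace Ω),
        CondIndepFun (MeasurableSpace.comap (trajectory (imageProcess f X)) inferInstance) hm
          (trajectory X) (trajectory Y) μ := by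
  obtain ⟨α, p, hX⟩ := hX
  obtain ⟨β, q, hY⟩ := hY
  obtain ⟨γ, r, hZ⟩ := hZ
  have : Nonempty A := ⟨α.support_nonempty.some⟩
  have : Nonempty B := ⟨β.support_nonempty.some⟩
  have mX : Measurable (trajectory Xbar) := measurable_pi_lambda _ hX.measurable
  have mY : Measurable (trajectory Ybar) := measurable_pi_lambda _ hY.measurable
  have mf := measurable_pathMap f
  have mg := measurable_pathMap g
  set P := μX.map (trajectory Xbar) with hP
  set P' := μY.map (trajectory Ybar) with hP'
  have : IsProbabilityMeasure P := Measure.isProbabilityMeasure_map mX.aemeasurable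
  have : IsProbabilityMeasure P' := Measure.isProbabilityMeasure_map mY.aemeasurable
  have hPZ : P.map (pathMap f) = μZ.map (trajectory Zbar) := by
    rw [hP, Measure.map_map mf mX]; exact hf.map_eq
  have hPP' : P.map (pathMap f) = P'.map (pathMap g) := by
    rw [hPZ, hP', Measure.map_map mg mY]; exact hg.map_eq
  obtain ⟨hsb, μ, hμ, hμQ, hm, hci⟩ := exists_measure_fiberProduct mf mg hPP'
  have mval : Measurable (Subtype.val : {p : (ℕ → A) × (ℕ → B) // pathMap f p.1 = pathMap g p.2} →
    (ℕ → A) × (ℕ → B)) := measurable_subtype_coe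
  have hμ1 : μ.map (fun ω => ω.1.1) = P := by
    refine Eq.trans ?_ (map_fst_relativeProduct (P' := P') (G := pathMap g) mf)
    rw [← hμQ, Measure.map_map measurable_fst mval]
    rfl
  have hμ2 : μ.map (fun ω => ω.1.2) = P' := by
    refine Eq.trans ?_ (map_snd_relativeProduct mg hPP')
    rw [← hμQ, Measure.map_map measurable_snd mval]
    rfl
  -- The trajectories of the coordinate processes are definitionally the two projections, so `hm`
  -- and `hci` apply unchanged.
  refine ⟨{p : (ℕ → A) × (ℕ → B) // pathMap f p.1 = pathMap g p.2}, inferInstance, hsb, μ, hμ,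
    fun t ω => ω.1.1 t, fun t ω => ω.1.2 t, ?_, ⟨mval.fst.aemeasurable, mX.aemeasurable, hμ1⟩,
    ⟨mval.snd.aemeasurable, mY.aemeasurable, hμ2⟩, fun t ω => congrFun ω.2 t,
    ⟨(mf.comp mval.fst).aemeasurable, hf.aemeasurable_snd, ?_⟩, hm, hci⟩
  · refine isMarkovChain_of_mul_comm (fun t => ?_) fun n w w' h0 h1 => ?_
    · exact ((measurable_pi_apply t).comp mval.fst).prodMk ((measurable_pi_apply t).comp mval.snd)
    have law (n : ℕ) (w : ℕ → A × B) :
        μ {ω | ∀ t ≤ n, (ω.1.1 t, ω.1.2 t) = w t} = relativeProduct P P' (pathMap f) (pathMap g)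
          (pathCylinder n (fun t => (w t).1) ×ˢ pathCylinder n (fun t => (w t).2)) := by
      rw [← hμQ, Measure.map_apply mval
        ((measurableSet_pathCylinder _ _).prod (measurableSet_pathCylinder _ _))]
      congr 1
      ext ω
      simp only [Set.mem_ofPred_eq, Set.mem_preimage, Set.mem_prod, pathCylinder, Prod.ext_iff]
      exact ⟨fun h => ⟨fun t ht => (h t ht).1, fun t ht => (h t ht).2⟩,
        fun h t ht => ⟨h.1 t ht, h.2 t ht⟩⟩
    rw [law, law, law, law]
    exact relativeProduct_pathCylinder_mul_comm hX.map_trajectory_pathCylinder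
      hY.map_trajectory_pathCylinder
      (fun n x => by rw [hPZ]; exact hZ.map_trajectory_pathCylinder n x) hPP'
      (congrArg Prod.fst h0) (congrArg Prod.snd h0) (congrArg Prod.fst h1) (congrArg Prod.snd h1)
  · rw [← hPZ, ← hμ1, Measure.map_map mf mval.fst]
    rfl
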